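/- Theorem 4.6. For integers $n, k, s$ with $0\le 2s\le k\le n+s$ let $W_{n,k,s}=K_s\vee\big((n-k+s)K_1\cup K_{k-2s}\big)$, i.e. the graph on $n$ vertices whose vertex set is partitioned into $X,Y,Z$ with $|X|=s$, $|Y|=k-2s$, $|Z|=n-(k-s)$, and whose edges are all pairs inside $X\cup Y$ and all pairs between $X$ and $Z$. Write $P_k$ for the path on $k$ vertices; a graph is $P_k$-free if it has no (not necessarily induced) subgraph isomorphic to $P_k$. Let $k\ge 4$ and $n\ge 2k$ be integers, let $p\ge 2$ be a real number, and let $t=\lfloor k/2\rfloor-1$. Then, among all connected $P_k$-free simple graphs on $n$ vertices, the graph $W_{n,k-1,t}$ is, up to isomorphism, the unique one that maximizes the degree power $\sum_{v}d(v)^p$. That is, a graph $G$ on $n$ vertices is connected, $P_k$-free and satisfies $\sum_{v\in V(H)}d_H(v)^p\le\sum_{v\in V(G)}d_G(v)^p$ for every connected $P_k$-free graph $H$ on $n$ vertices if and only if $G\cong W_{n,k-1,t}$. -/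

import Mathlib

/-- The graph `W_{n,k,s}` (meaningful for `2 * s ≤ k ≤ n + s`). The vertices `0, …, n - 1` are split
into `X = {i | i < s}`, `Y = {i | s ≤ i < k - s}` and `Z = {i | k - s ≤ i}`, which have `s`,
`k - 2 * s` and `n - (k - s)` elements. The edges are all pairs inside `X ∪ Y` and all pairs between
`X` and `Z`; that is, the graph is `K_s ∨ ((n - k + s) K_1 ∪ K_{k - 2 s})`. -/
def wGraph (n k s : ℕ) : SimpleGraph (Fin n) where
  Adj i j := i ≠ j ∧
    ((i.val < k - s ∧ j.val < k - s) ∨ (i.val < s ∧ k - s ≤ j.val) ∨ (j.val < s ∧ k - s ≤ i.val))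
  symm := ⟨by
    rintro i j ⟨hne, h⟩
    refine ⟨hne.symm, ?_⟩
    tauto⟩
  loopless := ⟨fun _ h => h.1 rfl⟩

open Classical in
/-- The degree power `∑ v, d(v) ^ p` of a finite graph, for a real exponent `p`. -/
noncomputable def degreePower {V : Type*} [Fintype V] (G : SimpleGraph V) (p : ℝ) : ℝ :=
  ∑ v : V, (G.degree v : ℝ) ^ p

/-- `G` is a connected graph without a path on `k` vertices (as a not necessarily induced subgraph),
and it has the maximum degree power among all such graphs on its vertex set. -/
def IsMaxDegreePowerConnectedPathFree {V : Type*} [Fintype V] (G : SimpleGraph V) (k : ℕ) (p : ℝ) :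
    Prop :=
  G.Connected ∧ (SimpleGraph.pathGraph k).Free G ∧
    ∀ H : SimpleGraph V, H.Connected → (SimpleGraph.pathGraph k).Free H →
      degreePower H p ≤ degreePower G p

namespace SimpleGraph

/-! The degree sequence of a maximizer `G` is weakly majorized by that of `W`, strict convexity of
`x ^ p` then forces equality of the sequences, and `W` is determined by its degrees.

A maximizer is edge-maximal: adding an edge would raise the degree power. Adding a missing edge `xy`
to an edge-maximal graph therefore creates a path on `k` vertices, which splits into two disjoint
paths of `G` issuing from `x` and `y`. Joining them through the apex of a cone over `G` and applying
a Pósa-type argument (`IsPathList.exists_long_of_cone_path`) gives a path in `G` that is too long if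
`x` and `y` both have many neighbours. Hence vertices of large degree are adjacent
(`adj_of_maximal`). It follows that the largest subset of minimum internal degree above `t` is empty
or a clique `B`, and that outside `B` the graph is `s`-degenerate for some `s ≤ t` with `|B| + s <
k` (`exists_relative_degeneracy`).

Peeling off vertices bounds the number `e(S)` of edges inside any vertex set `S`. Since the degrees
in `S` sum to at most `e(S) + e(G)`, every partial sum of the degree sequence is at most that of
`W`; for `|S| ≤ t` the bound `n - 1` on each degree suffices (`sum_degree_le_sum_wDegree`).
Karamata's inequality with its equality case (`Antitone.eq_of_sum_rpow_le`) and
`eq_wGraph_of_degree` identify the maximizer. The converse holds because a maximizer exists by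
finiteness and is isomorphic to `W`. -/

/-- A list of distinct vertices in which consecutive vertices are adjacent. -/
def IsPathList {V : Type*} (G : SimpleGraph V) (l : List V) : Prop :=
  l.IsChain G.Adj ∧ l.Nodup

/-- The last vertex of the list is adjacent to the first one. -/
def IsClosedList {V : Type*} (G : SimpleGraph V) (l : List V) : Prop :=
  ∀ a ∈ l.head?, ∀ b ∈ l.getLast?, G.Adj b a

/-! ### Paths as lists, bridges and rearrangements -/

section PathList

variable {V : Type*} {G : SimpleGraph V}

lemma isChain_adj_reverse {l : List V} : l.reverse.IsChain G.Adj ↔ l.IsChain G.Adj := by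
  rw [List.isChain_reverse]
  exact List.IsChain.iff fun a b => G.adj_comm b a

lemma IsPathList.reverse {l : List V} (h : G.IsPathList l) : G.IsPathList l.reverse :=
  ⟨isChain_adj_reverse.2 h.1, List.nodup_reverse.2 h.2⟩

lemma isPathList_append {l₁ l₂ : List V} : G.IsPathList (l₁ ++ l₂) ↔
    G.IsPathList l₁ ∧ G.IsPathList l₂ ∧ l₁.Disjoint l₂ ∧
      ∀ x ∈ l₁.getLast?, ∀ y ∈ l₂.head?, G.Adj x y := by
  simp only [IsPathList, List.isChain_append, List.nodup_append']
  tauto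

lemma pathGraph_isContained_iff {k : ℕ} :
    pathGraph k ⊑ G ↔ ∃ l, G.IsPathList l ∧ k ≤ l.length := by
  constructor
  · rintro ⟨f⟩
    refine ⟨List.ofFn f, ⟨?_, List.nodup_ofFn.2 f.injective⟩, by simp⟩
    rw [List.isChain_iff_getElem]
    intro i hi
    simp only [List.getElem_ofFn]
    exact f.toHom.map_rel (by simp [pathGraph_adj])
  · rintro ⟨l, hl, hk⟩
    refine ⟨⟨⟨fun i => l[i.val], ?_⟩, ?_⟩⟩
    · intro a b hab
      rw [pathGraph_adj] at hab
      have hc := List.isChain_iff_getElem.1 hl.1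
      rcases hab with h | h
      · have := hc a.val (by omega)
        simpa [h] using this
      · have := hc b.val (by omega)
        simpa [h] using this.symm
    · intro a b hab
      exact Fin.ext ((List.Nodup.getElem_inj_iff hl.2).1 hab)

/-- Two vertex sets of a connected graph are joined by a path with inner vertices outside both. -/
lemma Connected.exists_bridge (hG : G.Connected) {P Q : Set V} (hPQ : Disjoint P Q)
    (hP : P.Nonempty) (hQ : Q.Nonempty) :
    ∃ p ∈ P, ∃ q ∈ Q, ∃ T : List V, G.IsPathList (p :: (T ++ [q])) ∧
      ∀ z ∈ T, z ∉ P ∧ z ∉ Q := by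
  have hex : ∃ m : ℕ, ∃ p ∈ P, ∃ q ∈ Q, ∃ T : List V,
      G.IsPathList (p :: (T ++ [q])) ∧ T.length = m := by
    obtain ⟨p, hp⟩ := hP
    obtain ⟨q, hq⟩ := hQ
    obtain ⟨w, hw⟩ := (hG.preconnected p q).exists_isPath
    have hpq : p ≠ q := fun h => Set.disjoint_left.1 hPQ hp (h ▸ hq)
    cases w with
    | nil => exact absurd rfl hpq
    | cons h w =>
      have e : w.support = w.support.dropLast ++ [q] := by
        conv_lhs => rw [← List.dropLast_append_getLast w.support_ne_nil]
        simp
      refine ⟨_, p, hp, q, hq, w.support.dropLast, ?_, rfl⟩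
      rw [← e]
      exact ⟨(Walk.cons h w).isChain_adj_support, hw.support_nodup⟩
  classical
  -- In a shortest such path an inner vertex in `P` or `Q` could serve as a new end, giving a
  -- shorter path.
  obtain ⟨p, hp, q, hq, T, hT, hlen⟩ := Nat.find_spec hex
  refine ⟨p, hp, q, hq, T, hT, fun z hz => ⟨fun hzP => ?_, fun hzQ => ?_⟩⟩
  · obtain ⟨T₁, T₂, rfl⟩ := List.append_of_mem hz
    refine Nat.find_min hex (m := T₂.length) ?_ ⟨z, hzP, q, hq, T₂, ?_, rfl⟩
    · rw [← hlen]; simp; omega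
    · have : p :: (T₁ ++ z :: T₂ ++ [q]) = (p :: T₁) ++ z :: (T₂ ++ [q]) := by simp
      rw [this, isPathList_append] at hT
      exact hT.2.1
  · obtain ⟨T₁, T₂, rfl⟩ := List.append_of_mem hz
    refine Nat.find_min hex (m := T₁.length) ?_ ⟨p, hp, z, hzQ, T₁, ?_, rfl⟩
    · rw [← hlen]; simp
    · have : p :: (T₁ ++ z :: T₂ ++ [q]) = (p :: (T₁ ++ [z])) ++ (T₂ ++ [q]) := by simp
      rw [this, isPathList_append] at hT
      exact hT.1

lemma _root_.List.eq_append_cons_last_of_exists {α : Type*} {q : α → Prop} :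
    ∀ {l : List α}, (∃ a ∈ l, q a) → ∃ l₁ z l₂, l = l₁ ++ z :: l₂ ∧ q z ∧ ∀ a ∈ l₂, ¬ q a
  | [], h => by simp at h
  | b :: l, h => by
    by_cases hl : ∃ a ∈ l, q a
    · obtain ⟨l₁, z, l₂, rfl, hz, h₂⟩ := List.eq_append_cons_last_of_exists hl
      exact ⟨b :: l₁, z, l₂, rfl, hz, h₂⟩
    · push Not at hl
      refine ⟨[], b, l, rfl, ?_, hl⟩
      obtain ⟨a, ha, hqa⟩ := h
      rcases List.mem_cons.1 ha with rfl | ha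
      · exact hqa
      · exact absurd hqa (hl a ha)

/-- The vertices of a path starting at `x` can be rearranged so as to end at a given vertex `p`,
losing none of the neighbours of `x`. -/
lemma IsPathList.exists_rearrange {x p : V} {l : List V} (hl : G.IsPathList (x :: l))
    (hp : p ∈ x :: l) :
    ∃ m, G.IsPathList (m ++ [p]) ∧ m ++ [p] ⊆ x :: l ∧ x ∈ m ++ [p] ∧
      ∀ z ∈ x :: l, G.Adj x z → z ∈ m ++ [p] := by
  obtain ⟨A, B, hAB⟩ := List.append_of_mem hp
  rcases A with _ | ⟨x', A⟩
  · simp only [List.nil_append, List.cons.injEq] at hAB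
    obtain ⟨rfl, rfl⟩ := hAB
    have := hl.reverse
    rw [List.reverse_cons] at this
    refine ⟨l.reverse, this, ?_, by simp, ?_⟩
    · intro z; simp; tauto
    · intro z; simp; tauto
  · simp only [List.cons_append, List.cons.injEq] at hAB
    obtain ⟨rfl, rfl⟩ := hAB
    by_cases hq : ∃ a ∈ p :: B, G.Adj x a
    · obtain ⟨l₁, z, l₂, h, hz, h₂⟩ := List.eq_append_cons_last_of_exists hq
      have key : ∃ C, l₁ ++ [z] = p :: C := by
        rcases l₁ with _ | ⟨p', l₁⟩
        · simp at h; exact ⟨[], by simp [h.1]⟩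
        · simp at h; exact ⟨l₁ ++ [z], by simp [h.1]⟩
      obtain ⟨C, hC⟩ := key
      have e : x :: (A ++ p :: B) = (x :: A) ++ ((p :: C) ++ l₂) := by
        rw [h, ← hC]; simp
      have hl' := hl
      rw [e, isPathList_append, isPathList_append] at hl'
      obtain ⟨h1, ⟨h2, -, -, -⟩, hd, -⟩ := hl'
      have e2 : (A.reverse ++ x :: C.reverse) ++ [p] = (x :: A).reverse ++ (p :: C).reverse := by
        simp
      have hzl : z ∈ (p :: C).getLast? := by rw [← hC]; simp
      refine ⟨A.reverse ++ x :: C.reverse, ?_, ?_, by simp, ?_⟩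
      · rw [e2, isPathList_append]
        refine ⟨h1.reverse, h2.reverse, ?_, ?_⟩
        · intro a ha hb
          exact hd (List.mem_reverse.1 ha) (List.mem_append_left _ (List.mem_reverse.1 hb))
        · intro a ha b hb
          rw [List.head?_reverse] at hb
          have hb' : b = z := Option.mem_unique hb hzl
          simp at ha
          subst ha; subst hb'; exact hz
      · rw [e2, e]
        intro a ha
        simp only [List.mem_append, List.mem_reverse] at ha ⊢
        tauto
      · intro a ha haz
        rw [e] at ha
        rw [e2]
        simp only [List.mem_append, List.mem_reverse] at ha ⊢
        rcases ha with ha | ha | ha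
        · exact Or.inl ha
        · exact Or.inr ha
        · exact absurd haz (h₂ a ha)
    · push Not at hq
      have e : x :: (A ++ p :: B) = (x :: A ++ [p]) ++ B := by simp
      have hl' := hl
      rw [e, isPathList_append] at hl'
      refine ⟨x :: A, hl'.1, ?_, by simp, ?_⟩
      · rw [e]; exact List.subset_append_left _ _
      · intro a ha haz
        rw [show x :: (A ++ p :: B) = (x :: A) ++ (p :: B) by simp, List.mem_append] at ha
        rcases ha with ha | ha
        · exact List.mem_append_left _ ha
        · exact absurd haz (hq a ha)

end PathList

/-! ### Crossing neighbours and long cycles -/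

/-- A crossing pair with the smallest gap works. `X` and `Y` are the positions, on a path with `L`
vertices, of the neighbours of its first and last vertex; `i + 1 + (L - j)` is the length of the
cycle that skips the vertices strictly between `i` and `j`. -/
lemma _root_.Finset.exists_crossing {X Y : Finset ℕ} {L : ℕ} (hX : ∀ a ∈ X, 1 ≤ a ∧ a < L)
    (hY : ∀ b ∈ Y, b + 1 < L) (h : ∃ i ∈ Y, ∃ j ∈ X, i < j) :
    ∃ i ∈ Y, ∃ j ∈ X, i < j ∧ min L (X.card + Y.card) ≤ i + 1 + (L - j) := by
  classical
  have hex : ∃ m, ∃ i ∈ Y, ∃ j ∈ X, i < j ∧ j - i = m := by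
    obtain ⟨i, hi, j, hj, hij⟩ := h
    exact ⟨_, i, hi, j, hj, hij, rfl⟩
  obtain ⟨i, hi, j, hj, hij, hm⟩ := Nat.find_spec hex
  have hmin : ∀ i' ∈ Y, ∀ j' ∈ X, i' < j' → j - i ≤ j' - i' := by
    intro i' hi' j' hj' hij'
    rw [hm]
    exact Nat.find_min' hex ⟨i', hi', j', hj', hij', rfl⟩
  refine ⟨i, hi, j, hj, hij, ?_⟩
  by_cases hd : j = i + 1
  · have := hX j hj
    omega
  · refine (min_le_right _ _).trans ?_
    -- By minimality, `X \ {j}` shifted down by one is disjoint from `Y`, as an overlap would be a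
    -- crossing of gap one, and neither set has an element strictly between `i` and `j`.
    set X' := (X.erase j).image (fun l => l - 1) with hX'
    have hc : X'.card = X.card - 1 := by
      rw [hX', Finset.card_image_of_injOn, Finset.card_erase_of_mem hj]
      intro a ha b hb hab
      have h1 := (hX a (Finset.mem_of_mem_erase ha)).1
      have h2 := (hX b (Finset.mem_of_mem_erase hb)).1
      simp only at hab
      omega
    have hdis : Disjoint X' Y := by
      rw [Finset.disjoint_left]
      intro a ha hb
      obtain ⟨l, hl, rfl⟩ := Finset.mem_image.1 ha
      have hl' := Finset.mem_of_mem_erase hl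
      have h1 := (hX l hl').1
      have := hmin _ hb l hl' (by omega)
      omega
    have hsub : X' ∪ Y ⊆ Finset.range (i + 1) ∪ Finset.Ico j (L - 1) := by
      intro a ha
      simp only [Finset.mem_union, Finset.mem_range, Finset.mem_Ico]
      rcases Finset.mem_union.1 ha with ha | ha
      · obtain ⟨l, hl, rfl⟩ := Finset.mem_image.1 ha
        have hl' := Finset.mem_of_mem_erase hl
        have hne := Finset.ne_of_mem_erase hl
        have h1 := hX l hl'
        by_contra hcon
        have := hmin i hi l hl' (by omega)
        omega
      · have h1 := hY a ha
        by_contra hcon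
        have := hmin a ha j hj (by omega)
        omega
    have hcard := (Finset.card_le_card hsub).trans (Finset.card_union_le _ _)
    rw [Finset.card_union_of_disjoint hdis, hc] at hcard
    simp only [Finset.card_range, Nat.card_Ico] at hcard
    have h1 := hX j hj
    have h2 : 1 ≤ X.card := Finset.card_pos.2 ⟨j, hj⟩
    omega

/-- A path on which a neighbour of the last vertex precedes a neighbour of the first vertex can be
turned into a long cycle. -/
lemma IsPathList.exists_cycle_of_crossing {W : Type*} {G : SimpleGraph W}
    {l : List W} (hl : G.IsPathList l) {x y : W} (hx : x ∈ l.head?) (hy : y ∈ l.getLast?)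
    {A B : Finset W} (hA : ∀ a ∈ A, a ∈ l ∧ G.Adj x a)
    (hB : ∀ b ∈ B, b ∈ l ∧ G.Adj y b)
    (h : ∃ l₁ l₂, l = l₁ ++ l₂ ∧ (∃ b ∈ B, b ∈ l₁) ∧ ∃ a ∈ A, a ∈ l₂) :
    ∃ c, G.IsPathList c ∧ G.IsClosedList c ∧ min l.length (A.card + B.card) ≤ c.length := by
  classical
  have inj : Set.InjOn l.idxOf {a | a ∈ l} := fun a ha b hb hab => (List.idxOf_inj ha).1 hab
  have cX : (A.image l.idxOf).card = A.card :=
    Finset.card_image_of_injOn (inj.mono fun a ha => (hA a ha).1)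
  have cY : (B.image l.idxOf).card = B.card :=
    Finset.card_image_of_injOn (inj.mono fun a ha => (hB a ha).1)
  have hlast : ∀ b ∈ l, b ≠ y → l.idxOf b + 1 < l.length := by
    intro b hb hby
    have h1 := List.idxOf_lt_length_of_mem hb
    by_contra hcon
    have e : l.idxOf b = l.length - 1 := by omega
    rw [List.getLast?_eq_getElem?, ← e, List.getElem?_eq_getElem h1, List.getElem_idxOf] at hy
    exact hby (by simpa using hy)
  have hhead : ∀ a ∈ l, a ≠ x → 1 ≤ l.idxOf a := by
    intro a ha hax
    have h1 := List.idxOf_lt_length_of_mem ha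
    by_contra hcon
    have e : l.idxOf a = 0 := by omega
    rw [List.head?_eq_getElem?, ← e, List.getElem?_eq_getElem h1, List.getElem_idxOf] at hx
    exact hax (by simpa using hx)
  obtain ⟨i, hi, j, hj, hij, hlen⟩ := Finset.exists_crossing (L := l.length)
    (X := A.image l.idxOf) (Y := B.image l.idxOf)
    (by
      intro i hi
      obtain ⟨a, ha, rfl⟩ := Finset.mem_image.1 hi
      exact ⟨hhead a (hA a ha).1 (hA a ha).2.ne', List.idxOf_lt_length_of_mem (hA a ha).1⟩)
    (by
      intro i hi
      obtain ⟨a, ha, rfl⟩ := Finset.mem_image.1 hi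
      exact hlast a (hB a ha).1 (hB a ha).2.ne')
    (by
      obtain ⟨l₁, l₂, rfl, ⟨b, hb, hbl⟩, a, ha, hal⟩ := h
      refine ⟨_, Finset.mem_image_of_mem _ hb, _, Finset.mem_image_of_mem _ ha, ?_⟩
      have hal₁ : a ∉ l₁ := fun h => (isPathList_append.1 hl).2.2.1 h hal
      rw [List.idxOf_append_of_mem hbl, List.idxOf_append_of_notMem hal₁]
      exact (List.idxOf_lt_length_of_mem hbl).trans_le (Nat.le_add_right _ _))
  rw [cX, cY] at hlen
  obtain ⟨b, hb, rfl⟩ := Finset.mem_image.1 hi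
  obtain ⟨a, ha, rfl⟩ := Finset.mem_image.1 hj
  have hbl := List.idxOf_lt_length_of_mem (hB b hb).1
  have hal := List.idxOf_lt_length_of_mem (hA a ha).1
  set i := l.idxOf b with hi'
  set j := l.idxOf a with hj'
  have hbi : l[i] = b := List.getElem_idxOf hbl
  have haj : l[j] = a := List.getElem_idxOf hal
  -- The cycle runs from `x` to `b`, jumps to `y`, runs backwards to `a`, and closes at `x`.
  refine ⟨l.take (i + 1) ++ (l.drop j).reverse, ?_, ?_, ?_⟩
  · rw [isPathList_append]
    refine ⟨⟨hl.1.take _, hl.2.sublist (List.take_sublist _ _)⟩,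
      IsPathList.reverse ⟨hl.1.drop _, hl.2.sublist (List.drop_sublist _ _)⟩, ?_, ?_⟩
    · intro z h1 h2
      exact (List.disjoint_take_drop hl.2 (by omega : i + 1 ≤ j)) h1 (List.mem_reverse.1 h2)
    · intro u hu v hv
      rw [List.head?_reverse, List.getLast?_drop, if_neg (by omega)] at hv
      have hvy : v = y := Option.mem_unique hv hy
      have hub : u = b := by
        rw [List.getLast?_take, if_neg (by omega)] at hu
        simp [List.getElem?_eq_getElem hbl, hbi] at hu
        exact hu.symm
      rw [hvy, hub]
      exact (hB b hb).2.symm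
  · intro u hu v hv
    have hux : u = x := by
      have hne : l.take (i + 1) ≠ [] := List.ne_nil_of_length_pos (by simp; omega)
      rw [List.head?_append_of_ne_nil _ hne, List.head?_take, if_neg (by omega)] at hu
      exact Option.mem_unique hu hx
    have hva : v = a := by
      have hne : (l.drop j).reverse ≠ [] := List.ne_nil_of_length_pos (by simp; omega)
      rw [List.getLast?_append_of_ne_nil _ hne, List.getLast?_reverse, List.head?_drop,
        List.getElem?_eq_getElem hal, haj] at hv
      simpa using hv.symm
    rw [hux, hva]
    exact (hA a ha).2.symm
  · simp
    omega

/-! ### The cone and a Pósa-type lemma -/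

/-- The graph obtained by adding a vertex adjacent to every vertex. -/
def cone {V : Type*} (G : SimpleGraph V) : SimpleGraph (Option V) where
  Adj a b := a ≠ b ∧ ∀ x ∈ a, ∀ y ∈ b, G.Adj x y
  symm := ⟨fun _ _ h => ⟨h.1.symm, fun x hx y hy => (h.2 y hy x hx).symm⟩⟩
  loopless := ⟨fun _ h => h.1 rfl⟩

section Cone

variable {V : Type*} {G : SimpleGraph V}

@[simp] lemma cone_adj_some {u v : V} : G.cone.Adj (some u) (some v) ↔ G.Adj u v := by
  simp [cone]
  intro h
  exact h.ne

@[simp] lemma cone_adj_none_some {v : V} : G.cone.Adj none (some v) := by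
  simp [cone]

@[simp] lemma cone_adj_some_none {v : V} : G.cone.Adj (some v) none := by
  simp [cone]

lemma isPathList_cone_map_some {l : List V} :
    G.cone.IsPathList (l.map some) ↔ G.IsPathList l := by
  simp only [IsPathList, List.isChain_map, cone_adj_some,
    List.nodup_map_iff (Option.some_injective V)]

lemma _root_.List.exists_map_some_of_none_notMem {V : Type*} :
    ∀ {c : List (Option V)}, none ∉ c → ∃ l : List V, c = l.map some
  | [], _ => ⟨[], rfl⟩
  | none :: c, h => by simp at h
  | some a :: c, h => by
    obtain ⟨l, rfl⟩ := List.exists_map_some_of_none_notMem (c := c) (by simpa using h)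
    exact ⟨a :: l, rfl⟩

/-- A cycle opened at the apex is a path of `G` with one vertex fewer; a cycle avoiding the apex
already lies in `G`. -/
lemma IsPathList.exists_of_cone_cycle {c : List (Option V)} (hc : G.cone.IsPathList c)
    (hclosed : G.cone.IsClosedList c) : ∃ l, G.IsPathList l ∧ c.length ≤ l.length + 1 := by
  by_cases h : none ∈ c
  · obtain ⟨a, b, rfl⟩ := List.append_of_mem h
    rw [isPathList_append, show none :: b = [none] ++ b by rfl, isPathList_append] at hc
    obtain ⟨ha, ⟨-, hb, hd₂, -⟩, hd₁, -⟩ := hc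
    have hab : G.cone.IsPathList (b ++ a) := by
      rw [isPathList_append]
      refine ⟨hb, ha, fun z h1 h2 => hd₁ h2 (by simp [h1]), fun u hu v hv => ?_⟩
      refine hclosed v ?_ u ?_
      · cases a <;> simp_all
      · cases b <;> simp_all
    have hn : none ∉ b ++ a := by
      rw [List.mem_append]
      rintro (h | h)
      · exact hd₂ (by simp) h
      · exact hd₁ h (by simp)
    obtain ⟨l, hl⟩ := List.exists_map_some_of_none_notMem hn
    rw [hl, isPathList_cone_map_some] at hab
    refine ⟨l, hab, ?_⟩
    have := congrArg List.length hl
    simp at this ⊢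
    omega
  · obtain ⟨l, rfl⟩ := List.exists_map_some_of_none_notMem h
    exact ⟨l, isPathList_cone_map_some.1 hc, by simp⟩

/-- A version of Pósa's lemma: a path `x … y` through the apex of the cone over a connected graph
yields a path of the graph that is as long or has many vertices in terms of the degrees of `x`
and `y`. -/
lemma IsPathList.exists_long_of_cone_path (hG : G.Connected) {P Q : List V} {x y : V}
    (hR : G.cone.IsPathList (P.map some ++ none :: Q.map some)) (hx : x ∈ P.head?)
    (hy : y ∈ Q.getLast?) {A B : Finset V} (hA : ∀ a ∈ A, (a ∈ P ∨ a ∈ Q) ∧ G.Adj x a)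
    (hB : ∀ b ∈ B, (b ∈ P ∨ b ∈ Q) ∧ G.Adj y b) :
    ∃ l, G.IsPathList l ∧ min (P.length + Q.length) (A.card + B.card + 1) ≤ l.length := by
  classical
  have hR' := hR
  rw [isPathList_append, show none :: Q.map some = [none] ++ Q.map some by rfl,
    isPathList_append, isPathList_cone_map_some, isPathList_cone_map_some] at hR'
  obtain ⟨hP, ⟨-, hQ, -, -⟩, hd, -⟩ := hR'
  have hPQ : ∀ a ∈ P, a ∉ Q := fun a h1 h2 =>
    hd (List.mem_map_of_mem h1) (by simpa using h2)
  have hxP : x ∈ P := List.mem_of_mem_head? hx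
  have hyQ : y ∈ Q := List.mem_of_mem_getLast? hy
  set R := P.map some ++ none :: Q.map some with hRdef
  have hmemR : ∀ a : V, a ∈ P ∨ a ∈ Q → some a ∈ R := by
    intro a ha
    simpa [hRdef] using ha
  -- The apex neighbours both `x` and `y`, so a neighbour of `x` in `Q` or of `y` in `P` makes a
  -- crossing with it. Counting the apex in both neighbourhoods adds two to the cycle bound, and
  -- removing it costs one.
  by_cases hcross : (∃ a ∈ A, a ∈ Q) ∨ (∃ b ∈ B, b ∈ P)
  · obtain ⟨c, hc, hclosed, hlen⟩ := hR.exists_cycle_of_crossing (x := some x) (y := some y)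
      (A := Finset.insertNone A) (B := Finset.insertNone B)
      (by
        cases P with
        | nil => simp at hx
        | cons p P => simpa [hRdef] using hx)
      (by
        have hne : none :: Q.map some ≠ [] := by simp
        rw [hRdef, List.getLast?_append_of_ne_nil _ hne]
        cases Q with
        | nil => simp at hy
        | cons p P =>
          rw [List.map_cons, List.getLast?_cons_cons, ← List.map_cons, List.getLast?_map]
          simpa using hy)
      (by
        intro a ha
        cases a with
        | none => simp [hRdef]
        | some a =>
          have := hA a (by simpa using ha)
          exact ⟨hmemR a this.1, cone_adj_some.2 this.2⟩)
      (by
        intro a ha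
        cases a with
        | none => simp [hRdef]
        | some a =>
          have := hB a (by simpa using ha)
          exact ⟨hmemR a this.1, cone_adj_some.2 this.2⟩)
      (by
        rcases hcross with ⟨a, ha, haQ⟩ | ⟨b, hb, hbP⟩
        · exact ⟨P.map some ++ [none], Q.map some, by simp [hRdef], ⟨none, by simp, by simp⟩,
            some a, by simpa using ha, by simpa using haQ⟩
        · exact ⟨P.map some, none :: Q.map some, hRdef, ⟨some b, by simpa using hb,
            by simpa using hbP⟩, none, by simp, by simp⟩)
    obtain ⟨l, hl, hcl⟩ := IsPathList.exists_of_cone_cycle hc hclosed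
    refine ⟨l, hl, ?_⟩
    simp [hRdef] at hlen
    omega
  · push Not at hcross
    have hAP : ∀ a ∈ A, a ∈ P := fun a ha => (hA a ha).1.resolve_right (hcross.1 a ha)
    have hBQ : ∀ b ∈ B, b ∈ Q := fun b hb => (hB b hb).1.resolve_left (hcross.2 b hb)
    -- Without a crossing, the neighbours of `x` lie in `P` and those of `y` in `Q`. Both paths are
    -- rearranged to end at the ends of a bridge and are glued along it.
    obtain ⟨p, hp, q, hq, T, hT, hTd⟩ := hG.exists_bridge (P := {a | a ∈ P}) (Q := {a | a ∈ Q})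
      (Set.disjoint_left.2 hPQ) ⟨x, hxP⟩ ⟨y, hyQ⟩
    obtain ⟨P', rfl⟩ : ∃ P', P = x :: P' := by
      cases P with
      | nil => simp at hx
      | cons u P => simp at hx; exact ⟨P, by rw [hx]⟩
    obtain ⟨Q', hQ'⟩ : ∃ Q', Q.reverse = y :: Q' := by
      rw [← List.head?_reverse] at hy
      cases h : Q.reverse with
      | nil => simp [h] at hy
      | cons u P => simp [h] at hy; exact ⟨P, by rw [hy]⟩
    have hQr := hQ.reverse
    rw [hQ'] at hQr
    have hmemQ : ∀ a, a ∈ y :: Q' ↔ a ∈ Q := by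
      intro a
      rw [← hQ', List.mem_reverse]
    obtain ⟨m, hm, hms, hxm, hmx⟩ := hP.exists_rearrange hp
    obtain ⟨m', hm', hms', hym', hmy'⟩ := hQr.exists_rearrange ((hmemQ q).2 hq)
    have hA' : A.card + 1 ≤ (m ++ [p]).length := by
      rw [← List.toFinset_card_of_nodup hm.2,
        ← Finset.card_insert_of_notMem (s := A) (a := x) fun h => (hA x h).2.ne rfl]
      refine Finset.card_le_card fun a ha => ?_
      rw [List.mem_toFinset]
      rcases Finset.mem_insert.1 ha with rfl | ha
      · exact hxm
      · exact hmx a (hAP a ha) (hA a ha).2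
    have hB' : B.card + 1 ≤ (m' ++ [q]).length := by
      rw [← List.toFinset_card_of_nodup hm'.2,
        ← Finset.card_insert_of_notMem (s := B) (a := y) fun h => (hB y h).2.ne rfl]
      refine Finset.card_le_card fun a ha => ?_
      rw [List.mem_toFinset]
      rcases Finset.mem_insert.1 ha with rfl | ha
      · exact hym'
      · exact hmy' a ((hmemQ a).2 (hBQ a ha)) (hB a ha).2
    refine ⟨m ++ [p] ++ (T ++ (m' ++ [q]).reverse), ?_, ?_⟩
    · have e1 : p :: (T ++ [q]) = [p] ++ (T ++ [q]) := rfl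
      rw [e1, isPathList_append, isPathList_append] at hT
      obtain ⟨-, ⟨hT1, -, -, hTq⟩, -, hpT⟩ := hT
      have sP : ∀ z ∈ m ++ [p], z ∈ x :: P' := fun z hz => hms hz
      have sQ : ∀ z ∈ (m' ++ [q]).reverse, z ∈ Q := fun z hz =>
        (hmemQ z).1 (hms' (List.mem_reverse.1 hz))
      have hTm : G.IsPathList (T ++ (m' ++ [q]).reverse) := by
        rw [isPathList_append]
        refine ⟨hT1, hm'.reverse, fun z h1 h2 => (hTd z h1).2 (sQ z h2), fun u hu v hv => ?_⟩
        simp at hv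
        exact hTq u hu v (by simp [hv])
      rw [isPathList_append]
      refine ⟨hm, hTm, ?_, ?_⟩
      · intro z h1 h2
        rcases List.mem_append.1 h2 with h2 | h2
        · exact (hTd z h2).1 (sP z h1)
        · exact hPQ z (sP z h1) (sQ z h2)
      · intro u hu v hv
        simp at hu
        refine hpT u (by simp [hu]) v ?_
        cases T with
        | nil => simpa using hv
        | cons t T => simpa using hv
    · simp at hA' hB' ⊢
      omega

end Cone

/-! ### Edge-maximal graphs: cliques and degeneracy -/

section EdgeMaximal

variable {V : Type*} {G : SimpleGraph V}

lemma isChain_of_isChain_sup_edge {x y : V} {l : List V} (h : l.IsChain (G ⊔ edge x y).Adj)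
    (hxy : x ∉ l ∨ y ∉ l) : l.IsChain G.Adj := by
  refine h.imp_of_mem_imp fun a b ha hb hab => ?_
  rw [sup_adj, edge_adj] at hab
  rcases hab with hab | ⟨⟨rfl, rfl⟩ | ⟨rfl, rfl⟩, -⟩
  · exact hab
  · tauto
  · tauto

/-- A list without repetition uses the new edge at most once, so cutting there leaves two chains of
`G`. -/
lemma exists_split_of_isChain_sup_edge {x y : V} : ∀ {l : List V},
    l.IsChain (G ⊔ edge x y).Adj → l.Nodup → l.IsChain G.Adj ∨
      ∃ l₁ l₂ u v, l = (l₁ ++ [u]) ++ v :: l₂ ∧ (l₁ ++ [u]).IsChain G.Adj ∧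
        (v :: l₂).IsChain G.Adj ∧ (u = x ∧ v = y ∨ u = y ∧ v = x)
  | [], _, _ => Or.inl List.isChain_nil
  | [a], _, _ => Or.inl (List.isChain_singleton a)
  | a :: b :: l, h, hn => by
    rw [List.isChain_cons_cons] at h
    obtain ⟨ha, hn'⟩ := List.nodup_cons.1 hn
    by_cases hab : G.Adj a b
    · rcases exists_split_of_isChain_sup_edge h.2 hn' with h' | ⟨l₁, l₂, u, v, e, h₁, h₂, huv⟩
      · exact Or.inl (List.isChain_cons_cons.2 ⟨hab, h'⟩)
      · refine Or.inr ⟨a :: l₁, l₂, u, v, by simp [e], ?_, h₂, huv⟩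
        rw [List.cons_append, List.isChain_cons]
        refine ⟨fun z hz => ?_, h₁⟩
        have : z = b := by
          cases l₁ <;> simp_all
        rw [this]
        exact hab
    · right
      have hab' := h.1
      rw [sup_adj, edge_adj] at hab'
      have hab'' := (hab'.resolve_left hab).1
      refine ⟨[], l, a, b, rfl, List.isChain_singleton a, ?_, hab''⟩
      refine isChain_of_isChain_sup_edge h.2 ?_
      rcases hab'' with ⟨rfl, rfl⟩ | ⟨rfl, rfl⟩
      · exact Or.inl ha
      · exact Or.inr ha

lemma isPathList_cone_iff {P Q : List V} :
    G.cone.IsPathList (P.map some ++ none :: Q.map some) ↔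
      G.IsPathList P ∧ G.IsPathList Q ∧ P.Disjoint Q := by
  rw [isPathList_append, show none :: Q.map some = [none] ++ Q.map some by rfl,
    isPathList_append, isPathList_cone_map_some, isPathList_cone_map_some]
  constructor
  · rintro ⟨hP, ⟨-, hQ, -, -⟩, hd, -⟩
    exact ⟨hP, hQ, fun a h1 h2 => hd (List.mem_map_of_mem h1) (by simpa using h2)⟩
  · rintro ⟨hP, hQ, hd⟩
    refine ⟨hP, ⟨⟨List.isChain_singleton _, List.nodup_singleton _⟩, hQ, ?_, ?_⟩, ?_, ?_⟩
    · intro z h1 h2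
      simp only [List.mem_singleton] at h1
      simp [h1] at h2
    · intro u hu v hv
      simp at hu hv
      obtain ⟨a, -, rfl⟩ := hv
      rw [← hu]
      simp
    · intro z h1 h2
      obtain ⟨a, ha, rfl⟩ := List.mem_map.1 h1
      exact hd ha (by simpa using h2)
    · intro u hu v hv
      simp at hu hv
      obtain ⟨a, -, rfl⟩ := hu
      rw [← hv]
      simp

/-- Adding an edge to an edge-maximal graph creates the forbidden path, hence two disjoint paths
issuing from the ends of the new edge. -/
lemma exists_cone_path_of_maximal {k : ℕ} (hG : G.Connected) (hfree : (pathGraph k).Free G)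
    (hmax : ∀ H : SimpleGraph V, G ≤ H → H.Connected → (pathGraph k).Free H → H = G)
    {x y : V} (hxy : x ≠ y) (hadj : ¬ G.Adj x y) :
    ∃ P Q : List V, G.IsPathList P ∧ G.IsPathList Q ∧ P.Disjoint Q ∧ x ∈ P.head? ∧
      y ∈ Q.getLast? ∧ k ≤ P.length + Q.length := by
  have hnot : ¬ (pathGraph k).Free (G ⊔ edge x y) := by
    intro h
    have := hmax _ le_sup_left (hG.mono le_sup_left) h
    apply hadj
    rw [← this, sup_adj, edge_adj]
    exact Or.inr ⟨Or.inl ⟨rfl, rfl⟩, hxy⟩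
  rw [not_not, pathGraph_isContained_iff] at hnot
  obtain ⟨l, hl, hk⟩ := hnot
  rcases exists_split_of_isChain_sup_edge hl.1 hl.2 with h | ⟨l₁, l₂, u, v, rfl, h₁, h₂, huv⟩
  · exact absurd (pathGraph_isContained_iff.2 ⟨l, ⟨h, hl.2⟩, hk⟩) hfree
  · obtain ⟨n₁, n₂, hd⟩ := List.nodup_append'.1 hl.2
    have p₁ : G.IsPathList (l₁ ++ [u]) := ⟨h₁, n₁⟩
    have p₂ : G.IsPathList (v :: l₂) := ⟨h₂, n₂⟩
    rw [List.length_append] at hk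
    rcases huv with ⟨rfl, rfl⟩ | ⟨rfl, rfl⟩
    · refine ⟨_, _, p₁.reverse, p₂.reverse, ?_, by simp, by simp, ?_⟩
      · intro z h1 h2
        exact hd (List.mem_reverse.1 h1) (List.mem_reverse.1 h2)
      · rw [List.length_reverse, List.length_reverse]
        exact hk
    · exact ⟨_, _, p₂, p₁, hd.symm, by simp, by simp, by omega⟩

open Classical in
/-- Kopylov's argument: in an edge-maximal graph without a path on `k` vertices, two sets with
large degrees are completely joined to each other. -/
theorem adj_of_maximal [Fintype V] {k : ℕ} (hG : G.Connected) (hfree : (pathGraph k).Free G)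
    (hmax : ∀ H : SimpleGraph V, G ≤ H → H.Connected → (pathGraph k).Free H → H = G)
    {A B : Finset V} {a b : ℕ} (hab : k ≤ a + b + 1)
    (hA : ∀ x ∈ A, a ≤ {z ∈ A ∪ B | G.Adj x z}.card)
    (hB : ∀ y ∈ B, b ≤ {z ∈ B | G.Adj y z}.card)
    (hAB : ∀ x ∈ B, x ∉ A → ∀ y ∈ B, x ≠ y → G.Adj x y) {x y : V} (hx : x ∈ A) (hy : y ∈ B)
    (hxy : x ≠ y) : G.Adj x y := by
  have hshort : ∀ l, G.IsPathList l → l.length < k := by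
    intro l hl
    by_contra h
    exact hfree (pathGraph_isContained_iff.2 ⟨l, hl, not_lt.1 h⟩)
  by_contra hadj
  -- Among all missing pairs from `A × B`, take one whose two paths have the largest total length.
  -- Then all relevant neighbours of `x` and `y` lie on these paths.
  set M : Set ℕ := {m | ∃ x ∈ A, ∃ y ∈ B, x ≠ y ∧ ¬ G.Adj x y ∧ ∃ P Q : List V,
    G.IsPathList P ∧ G.IsPathList Q ∧ P.Disjoint Q ∧ x ∈ P.head? ∧
      y ∈ Q.getLast? ∧ P.length + Q.length = m} with hM
  obtain ⟨P₀, Q₀, hP₀, hQ₀, hd₀, hx₀, hy₀, hk₀⟩ :=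
    exists_cone_path_of_maximal hG hfree hmax hxy hadj
  have hmem₀ : P₀.length + Q₀.length ∈ M :=
    ⟨x, hx, y, hy, hxy, hadj, P₀, Q₀, hP₀, hQ₀, hd₀, hx₀, hy₀, rfl⟩
  have hbdd : BddAbove M := by
    refine ⟨Fintype.card V, ?_⟩
    rintro m ⟨x, -, y, -, -, -, P, Q, hP, hQ, hd, -, -, rfl⟩
    rw [← List.length_append]
    exact (List.nodup_append'.2 ⟨hP.2, hQ.2, hd⟩).length_le_card
  have hge : k ≤ sSup M := hk₀.trans (le_csSup hbdd hmem₀)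
  obtain ⟨x, hx, y, hy, hxy, hadj, P, Q, hP, hQ, hd, hxP, hyQ, hm⟩ := Nat.sSup_mem ⟨_, hmem₀⟩ hbdd
  have hlong : ∀ m ∈ M, m ≤ P.length + Q.length := fun m hm' => hm ▸ le_csSup hbdd hm'
  have hxP' : x ∈ P := List.mem_of_mem_head? hxP
  have hyQ' : y ∈ Q := List.mem_of_mem_getLast? hyQ
  -- A common neighbour of `x` and `y` off the paths would link them into a path on more than `k`
  -- vertices.
  have hclose : ∀ z, z ∉ P → z ∉ Q → G.Adj x z → ¬ G.Adj z y := by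
    intro z hzP hzQ hxz hzy
    have hzP₂ : G.IsPathList ([z] ++ P) := by
      rw [isPathList_append]
      refine ⟨⟨List.isChain_singleton _, List.nodup_singleton _⟩, hP, by simpa using hzP, ?_⟩
      intro u hu v hv
      simp at hu
      rw [← hu, Option.mem_unique hv hxP]
      exact hxz.symm
    have : G.IsPathList (Q ++ ([z] ++ P)) := by
      rw [isPathList_append]
      refine ⟨hQ, hzP₂, ?_, ?_⟩
      · intro w h1 h2
        rcases List.mem_append.1 h2 with h2 | h2
        · rw [List.mem_singleton] at h2
          exact hzQ (h2 ▸ h1)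
        · exact hd h2 h1
      · intro u hu v hv
        simp at hv
        rw [← hv, Option.mem_unique hu hyQ]
        exact hzy.symm
    have := hshort _ this
    simp at this
    omega
  have hxn : ∀ z ∈ {z ∈ A ∪ B | G.Adj x z}, (z ∈ P ∨ z ∈ Q) ∧ G.Adj x z := by
    intro z hz
    obtain ⟨hzAB, hxz⟩ := Finset.mem_filter.1 hz
    refine ⟨?_, hxz⟩
    by_contra hcon
    push Not at hcon
    have hzy : z ≠ y := fun h => hcon.2 (h ▸ hyQ')
    have hnadj := hclose z hcon.1 hcon.2 hxz
    -- If `z ∈ A`, prepending it to `P` contradicts the choice of the pair; if `z ∈ B \ A`, then `z`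
    -- is adjacent to `y` by `hAB`.
    by_cases hzA : z ∈ A
    · have : (z :: P).length + Q.length ∈ M := by
        refine ⟨z, hzA, y, hy, hzy, hnadj, z :: P, Q, ⟨?_, List.nodup_cons.2 ⟨hcon.1, hP.2⟩⟩, hQ,
          List.disjoint_cons_left.2 ⟨hcon.2, hd⟩, by simp, hyQ, rfl⟩
        rw [List.isChain_cons]
        refine ⟨fun v hv => ?_, hP.1⟩
        rw [Option.mem_unique hv hxP]
        exact hxz.symm
      have := hlong _ this
      simp at this
    · exact hnadj (hAB z ((Finset.mem_union.1 hzAB).resolve_left hzA) hzA y hy hzy)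
  have hyn : ∀ z ∈ {z ∈ B | G.Adj y z}, (z ∈ P ∨ z ∈ Q) ∧ G.Adj y z := by
    intro z hz
    obtain ⟨hzB, hyz⟩ := Finset.mem_filter.1 hz
    refine ⟨?_, hyz⟩
    by_contra hcon
    push Not at hcon
    have hxz : x ≠ z := fun h => hcon.1 (h ▸ hxP')
    have hnadj : ¬ G.Adj x z := fun h => hclose z hcon.1 hcon.2 h hyz.symm
    have : P.length + (Q ++ [z]).length ∈ M := by
      have hQz : G.IsPathList (Q ++ [z]) := by
        rw [isPathList_append]
        refine ⟨hQ, ⟨List.isChain_singleton _, List.nodup_singleton _⟩, by simpa using hcon.2, ?_⟩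
        intro u hu v hv
        simp at hv
        rw [← hv, Option.mem_unique hu hyQ]
        exact hyz
      refine ⟨x, hx, z, hzB, hxz, hnadj, P, Q ++ [z], hP, hQz, ?_, hxP, by simp, rfl⟩
      intro w h1 h2
      rcases List.mem_append.1 h2 with h2 | h2
      · exact hd h1 h2
      · rw [List.mem_singleton] at h2
        exact hcon.1 (h2 ▸ h1)
    have := hlong _ this
    simp at this
  obtain ⟨l, hl, hlen⟩ := IsPathList.exists_long_of_cone_path hG
    (isPathList_cone_iff.2 ⟨hP, hQ, hd⟩) hxP hyQ hxn hyn
  have h1 := hshort l hl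
  have h2 := hA x hx
  have h3 := hB y hy
  rw [hm] at hlen
  omega

open Classical in
/-- An edge-maximal connected graph without a path on `k` vertices is `s`-degenerate relative to a
set of at most `k - 1 - s` vertices. -/
theorem exists_relative_degeneracy [Fintype V] {k t : ℕ} (hG : G.Connected)
    (hfree : (pathGraph k).Free G)
    (hmax : ∀ H : SimpleGraph V, G ≤ H → H.Connected → (pathGraph k).Free H → H = G)
    (ht : t + 1 ≤ k) (hk : k ≤ 2 * t + 3) :
    ∃ s ≤ t, ∃ B : Finset V, B.card + s + 1 ≤ k ∧
      ∀ S : Finset V, ¬ S ⊆ B → ∃ v ∈ S \ B, {w ∈ S | G.Adj v w}.card ≤ s := by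
  by_cases hdeg : ∀ S : Finset V, S.Nonempty → ∃ v ∈ S, {w ∈ S | G.Adj v w}.card ≤ t
  · refine ⟨t, le_rfl, ∅, by simpa using ht, fun S hS => ?_⟩
    obtain ⟨v, hv, h⟩ := hdeg S (by
      rw [Finset.nonempty_iff_ne_empty]
      rintro rfl
      exact hS (Finset.empty_subset _))
    exact ⟨v, by simpa using hv, h⟩
  push Not at hdeg
  obtain ⟨S₀, hS₀, hS₀d⟩ := hdeg
  -- `B` is a largest set of minimum internal degree above `t`. Two degrees of at least `t + 1`
  -- satisfy the condition of `adj_of_maximal` because `k ≤ 2 * t + 3`, so `B` is a clique.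
  obtain ⟨B, hB, hBmax⟩ := Finset.exists_max_image
    (Finset.univ.filter fun S : Finset V => S.Nonempty ∧ ∀ v ∈ S, t < {w ∈ S | G.Adj v w}.card)
    Finset.card ⟨S₀, by simpa using ⟨hS₀, hS₀d⟩⟩
  obtain ⟨-, ⟨v₀, hv₀⟩, hBd⟩ := Finset.mem_filter.1 hB
  have hclique : ∀ x ∈ B, ∀ y ∈ B, x ≠ y → G.Adj x y := by
    intro x hx y hy hxy
    refine adj_of_maximal hG hfree hmax (A := B) (B := B) (a := t + 1) (b := t + 1) (by omega)
      ?_ ?_ (fun x hx h => absurd hx h) hx hy hxy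
    · intro x hx
      rw [Finset.union_self]
      exact hBd x hx
    · intro x hx
      exact hBd x hx
  have hnb : ∀ x ∈ B, {w ∈ B | G.Adj x w} = B.erase x := by
    intro x hx
    ext w
    simp only [Finset.mem_filter, Finset.mem_erase]
    exact ⟨fun h => ⟨h.2.ne', h.1⟩, fun h => ⟨h.2, hclique x hx w h.2 h.1.symm⟩⟩
  have hcard : t + 2 ≤ B.card := by
    have := hBd v₀ hv₀
    rw [hnb v₀ hv₀, Finset.card_erase_of_mem hv₀] at this
    omega
  have hcard' : B.card < k := by
    by_contra hcon
    refine hfree (pathGraph_isContained_iff.2 ⟨B.toList, ⟨?_, B.nodup_toList⟩, by simpa using hcon⟩)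
    refine List.Pairwise.isChain ?_
    refine B.nodup_toList.pairwise_of_forall_ne fun a ha b hb hab => ?_
    exact hclique a (Finset.mem_toList.1 ha) b (Finset.mem_toList.1 hb) hab
  -- This `s` is at most `t` since `B` has at least `t + 2` vertices. If degeneracy failed for `S`,
  -- the degree bounds `s + 1` on `S \ B` and `|B| - 1` on `B` would join each vertex of `S \ B` to
  -- all of `B`, and `B` could be enlarged.
  refine ⟨k - 1 - B.card, by omega, B, by omega, fun S hS => ?_⟩
  by_contra hcon
  push Not at hcon
  obtain ⟨x, hxS, hxB⟩ := Finset.not_subset.1 hS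
  have hjoin : ∀ y ∈ B, G.Adj x y := by
    intro y hy
    refine adj_of_maximal hG hfree hmax (A := S \ B) (B := B) (a := k - 1 - B.card + 1)
      (b := B.card - 1) (by omega) ?_ ?_ (fun x hx _ => hclique x hx)
      (Finset.mem_sdiff.2 ⟨hxS, hxB⟩) hy (fun h => hxB (h ▸ hy))
    · intro z hz
      refine (hcon z hz).trans_le (Finset.card_le_card ?_)
      refine Finset.filter_subset_filter _ ?_
      intro w hw
      simp [hw]
    · intro z hz
      rw [hnb z hz, Finset.card_erase_of_mem hz]
  have hins : insert x B ∈ (Finset.univ.filter fun S : Finset V =>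
      S.Nonempty ∧ ∀ v ∈ S, t < {w ∈ S | G.Adj v w}.card) := by
    refine Finset.mem_filter.2 ⟨Finset.mem_univ _, Finset.insert_nonempty _ _, fun v hv => ?_⟩
    rcases Finset.mem_insert.1 hv with rfl | hv
    · have : B ⊆ {w ∈ insert v B | G.Adj v w} := fun w hw =>
        Finset.mem_filter.2 ⟨Finset.mem_insert_of_mem hw, hjoin w hw⟩
      have := Finset.card_le_card this
      omega
    · exact (hBd v hv).trans_le
        (Finset.card_le_card (Finset.filter_subset_filter _ (Finset.subset_insert _ _)))
  have := hBmax _ hins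
  rw [Finset.card_insert_of_notMem hxB] at this
  omega

end EdgeMaximal

/-! ### Counting edges and sums of degrees -/

section Counting

variable {V : Type*} {G : SimpleGraph V}

open Classical in
lemma sum_card_filter_adj_insert {v : V} {T : Finset V} (hv : v ∉ T) :
    ∑ x ∈ insert v T, {w ∈ insert v T | G.Adj x w}.card =
      ∑ x ∈ T, {w ∈ T | G.Adj x w}.card + 2 * {w ∈ T | G.Adj v w}.card := by
  have h₁ : ∀ x, {w ∈ insert v T | G.Adj x w}.card =
      {w ∈ T | G.Adj x w}.card + if G.Adj x v then 1 else 0 := by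
    intro x
    rw [Finset.filter_insert]
    split_ifs with h
    · rw [Finset.card_insert_of_notMem (by simp [hv])]
    · rfl
  rw [Finset.sum_insert hv]
  simp only [h₁, Finset.sum_add_distrib, SimpleGraph.irrefl, if_false]
  have h₂ : ∑ x ∈ T, (if G.Adj x v then 1 else 0) = {w ∈ T | G.Adj v w}.card := by
    rw [Finset.card_filter]
    exact Finset.sum_congr rfl fun x _ => if_congr (G.adj_comm x v) rfl rfl
  rw [h₂]
  omega

open Classical in
/-- The number of edges inside a set of vertices of a graph that is `s`-degenerate relative to a
set of at most `h` vertices. -/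
lemma sum_card_filter_adj_le {s h : ℕ} {B : Finset V} (hB : B.card ≤ h)
    (hdeg : ∀ S : Finset V, ¬ S ⊆ B → ∃ v ∈ S \ B, {w ∈ S | G.Adj v w}.card ≤ s) (S : Finset V) :
    ∑ x ∈ S, {w ∈ S | G.Adj x w}.card ≤ 2 * ∑ j ∈ Finset.range S.card, if j < h then j else s := by
  induction hn : S.card generalizing S with
  | zero =>
    rw [Finset.card_eq_zero] at hn
    simp [hn]
  | succ n ih =>
    -- Peel off one vertex. With more than `h` vertices, `S` is not inside `B` and degeneracy
    -- applies; otherwise only the trivial degree bound is used.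
    obtain ⟨v, hv, hvd⟩ : ∃ v ∈ S, {w ∈ S | G.Adj v w}.card ≤ if n < h then n else s := by
      have hself : ∀ v ∈ S, {w ∈ S | G.Adj v w}.card ≤ n := by
        intro v hv
        have : {w ∈ S | G.Adj v w} ⊆ S.erase v := by
          intro w hw
          obtain ⟨hw, hvw⟩ := Finset.mem_filter.1 hw
          exact Finset.mem_erase.2 ⟨hvw.ne', hw⟩
        have := Finset.card_le_card this
        rw [Finset.card_erase_of_mem hv] at this
        omega
      split_ifs with hnh
      · obtain ⟨v, hv⟩ : S.Nonempty := Finset.card_pos.1 (by omega)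
        exact ⟨v, hv, hself v hv⟩
      · obtain ⟨v, hv, hvd⟩ := hdeg S fun hSB => by
          have := Finset.card_le_card hSB
          omega
        exact ⟨v, (Finset.mem_sdiff.1 hv).1, hvd⟩
    have hvT := Finset.notMem_erase v S
    have hS : insert v (S.erase v) = S := Finset.insert_erase hv
    have h₁ := ih (S.erase v) (by rw [Finset.card_erase_of_mem hv]; omega)
    have h₂ := sum_card_filter_adj_insert (G := G) hvT
    rw [hS] at h₂
    have h₃ : {w ∈ S.erase v | G.Adj v w}.card ≤ {w ∈ S | G.Adj v w}.card :=
      Finset.card_le_card (Finset.filter_subset_filter _ (Finset.erase_subset _ _))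
    rw [h₂, Finset.sum_range_succ]
    omega

-- Edges inside `S` count twice in its degree sum and edges leaving `S` once, so the sum is at most
-- `e(S) + e(G)`. Everything is doubled to avoid halving.
open Classical in
lemma two_mul_sum_degree_le [Fintype V] (S : Finset V) :
    2 * ∑ v ∈ S, G.degree v ≤
      ∑ v ∈ S, {w ∈ S | G.Adj v w}.card +
        ∑ v : V, {w ∈ (Finset.univ : Finset V) | G.Adj v w}.card := by
  have hd : ∀ v : V, {w ∈ (Finset.univ : Finset V) | G.Adj v w}.card = G.degree v := by
    intro v
    rw [← card_neighborFinset_eq_degree, neighborFinset_eq_filter]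
  have hsplit : ∀ v, G.degree v = {w ∈ S | G.Adj v w}.card + {w ∈ Sᶜ | G.Adj v w}.card := by
    intro v
    rw [← hd v, ← Finset.card_union_of_disjoint
      (Finset.disjoint_filter_filter disjoint_compl_right), ← Finset.filter_union,
      Finset.union_compl]
  have hcross : ∑ v ∈ S, {w ∈ Sᶜ | G.Adj v w}.card = ∑ v ∈ Sᶜ, {w ∈ S | G.Adj v w}.card := by
    simp only [Finset.card_filter]
    rw [Finset.sum_comm]
    simp only [G.adj_comm]
  have h₁ : ∑ v ∈ S, G.degree v =
      ∑ v ∈ S, {w ∈ S | G.Adj v w}.card + ∑ v ∈ S, {w ∈ Sᶜ | G.Adj v w}.card := by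
    rw [← Finset.sum_add_distrib]
    exact Finset.sum_congr rfl fun v _ => hsplit v
  have h₂ : ∑ v ∈ Sᶜ, {w ∈ S | G.Adj v w}.card ≤ ∑ v ∈ Sᶜ, G.degree v :=
    Finset.sum_le_sum fun v _ => by rw [hsplit v]; omega
  have h₃ : ∑ v : V, {w ∈ (Finset.univ : Finset V) | G.Adj v w}.card =
      ∑ v ∈ S, G.degree v + ∑ v ∈ Sᶜ, G.degree v := by
    rw [Finset.sum_add_sum_compl]
    exact Finset.sum_congr rfl fun v _ => hd v
  omega

end Counting

/-! ### Weak majorization by the degrees of `W` -/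

/-- The degree of the vertex `i` of `wGraph n (k - 1) t`. -/
def wDegree (n k t i : ℕ) : ℕ :=
  if i < t then n - 1 else if i < k - 1 - t then k - 2 - t else t

lemma two_mul_sum_range_ite_of_le {h s m : ℕ} (hm : m ≤ h) :
    2 * ∑ j ∈ Finset.range m, (if j < h then j else s) = m * (m - 1) := by
  rw [Finset.sum_congr rfl (g := fun j => j), mul_comm, Finset.sum_range_id_mul_two]
  intro j hj
  rw [if_pos ((Finset.mem_range.1 hj).trans_le hm)]

lemma two_mul_sum_range_ite_add {h s r : ℕ} :
    2 * ∑ j ∈ Finset.range (h + r), (if j < h then j else s) = h * (h - 1) + 2 * (s * r) := by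
  rw [Finset.sum_range_add, mul_add, two_mul_sum_range_ite_of_le le_rfl]
  simp [mul_comm]

lemma sum_range_wDegree {n k t r : ℕ} :
    ∑ i ∈ Finset.range (t + r), wDegree n k t i = t * (n - 1) +
      ∑ i ∈ Finset.range r, if i < k - 1 - 2 * t then k - 2 - t else t := by
  rw [Finset.sum_range_add]
  congr 1
  · rw [Finset.sum_congr rfl (g := fun _ => n - 1)]
    · simp
    · intro i hi
      rw [wDegree, if_pos (Finset.mem_range.1 hi)]
  · refine Finset.sum_congr rfl fun i _ => ?_
    rw [wDegree, if_neg (by omega)]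
    congr 1
    simp only [eq_iff_iff]
    omega

/-- Writing `t = s + u`, `m = t + r + 1` and `n = k - 1 - s + N` turns this into a polynomial
inequality. The loss from `s < t` is quadratic in `u` and is paid for by `u * (u + 3) ≤ u * N`,
which `2 * k ≤ n` provides. From index `t` on, `wDegree` is constantly `t` for even `k`, and starts
with two values `t + 1` for odd `k`. -/
lemma sum_range_add_sum_range_le_sum_wDegree {n k t s m : ℕ} (hk : k = 2 * t + 2 ∨ k = 2 * t + 3)
    (hn : 2 * k ≤ n) (hs : s ≤ t) (hm : t < m) (hmn : m ≤ n) :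
    2 * ∑ j ∈ Finset.range m, (if j < k - 1 - s then j else s) +
      2 * ∑ j ∈ Finset.range n, (if j < k - 1 - s then j else s) ≤
      2 * ∑ i ∈ Finset.range m, wDegree n k t i := by
  obtain ⟨u, rfl⟩ := Nat.exists_eq_add_of_le hs
  obtain ⟨r, rfl⟩ := Nat.exists_eq_add_of_lt hm
  rw [add_assoc (s + u) r 1, sum_range_wDegree]
  rcases hk with rfl | rfl
  · have e : 2 * (s + u) + 2 - 1 - s = s + 2 * u + 1 := by omega
    obtain ⟨N, rfl⟩ := Nat.exists_eq_add_of_le (show s + 2 * u + 1 ≤ n by omega)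
    have hN : u + 3 ≤ N := by omega
    have hT : ∑ i ∈ Finset.range (r + 1), (if i < 2 * (s + u) + 2 - 1 - 2 * (s + u) then
        2 * (s + u) + 2 - 2 - (s + u) else s + u) = (r + 1) * (s + u) := by
      rw [Finset.sum_congr rfl (g := fun _ => s + u)]
      · simp
      · intro i hi
        split_ifs <;> omega
    rw [hT, e, two_mul_sum_range_ite_add]
    have h₁ : u * (u + 3) ≤ u * N := Nat.mul_le_mul_left u hN
    -- The condition `r ≤ u` says that `m` does not exceed the threshold `k - 1 - s`.
    rcases le_or_gt r u with hru | hru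
    · rw [two_mul_sum_range_ite_of_le (by omega)]
      have h₂ : r * (r + 1) ≤ u * (u + 1) := Nat.mul_le_mul hru (by omega)
      simp only [← add_assoc, Nat.add_sub_cancel, Nat.add_right_comm _ 1 N]
      nlinarith
    · obtain ⟨q, rfl⟩ := Nat.exists_eq_add_of_lt hru
      rw [show s + u + (u + q + 1 + 1) = s + 2 * u + 1 + (q + 1) by ring,
        two_mul_sum_range_ite_add]
      simp only [Nat.add_sub_cancel, Nat.add_right_comm _ 1 N]
      nlinarith [Nat.zero_le (u * q)]
  · have e : 2 * (s + u) + 3 - 1 - s = s + 2 * u + 2 := by omega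
    obtain ⟨N, rfl⟩ := Nat.exists_eq_add_of_le (show s + 2 * u + 2 ≤ n by omega)
    have hN : u + 3 ≤ N := by omega
    have h₁ : u * (u + 3) ≤ u * N := Nat.mul_le_mul_left u hN
    have e₁ : 2 * (s + u) + 3 - 1 - 2 * (s + u) = 2 := by omega
    have e₂ : 2 * (s + u) + 3 - 2 - (s + u) = s + u + 1 := by omega
    have e₃ : s + 2 * u + 2 + N - 1 = s + 2 * u + 1 + N := by omega
    have e₄ : s + 2 * u + 2 - 1 = s + 2 * u + 1 := by omega
    rw [e, two_mul_sum_range_ite_add, e₁, e₂, e₃, e₄]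
    rcases Nat.eq_zero_or_pos r with rfl | hr
    · rw [two_mul_sum_range_ite_of_le (by omega)]
      simp
      nlinarith
    · obtain ⟨r, rfl⟩ := Nat.exists_eq_add_of_lt hr
      have hT : ∑ i ∈ Finset.range (0 + r + 1 + 1), (if i < 2 then s + u + 1 else s + u) =
          2 * (s + u + 1) + r * (s + u) := by
        have h2 : ∀ x, ¬ 2 + x < 2 := by omega
        rw [show 0 + r + 1 + 1 = 2 + r by ring, Finset.sum_range_add]
        simp only [h2, if_false]
        simp [Finset.sum_range_succ]
        ring
      rw [hT]
      rcases le_or_gt r u with hru | hru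
      · rw [two_mul_sum_range_ite_of_le (by omega)]
        have h₂ : r * (r + 3) ≤ u * (u + 3) := Nat.mul_le_mul hru (by omega)
        have e₅ : s + u + (0 + r + 1 + 1) - 1 = s + u + r + 1 := by omega
        rw [e₅]
        nlinarith
      · obtain ⟨q, rfl⟩ := Nat.exists_eq_add_of_lt hru
        rw [show s + u + (0 + (u + q + 1) + 1 + 1) = s + 2 * u + 2 + (q + 1) by ring,
          two_mul_sum_range_ite_add, e₄]
        nlinarith [Nat.zero_le (u * q)]

open Classical in
/-- The degree sequence of an edge-maximal connected graph without a path on `k` vertices is weakly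
majorized by that of `wGraph n (k - 1) t`. -/
theorem sum_degree_le_sum_wDegree {V : Type*} [Fintype V] {G : SimpleGraph V} {k t : ℕ}
    (hG : G.Connected) (hfree : (pathGraph k).Free G)
    (hmax : ∀ H : SimpleGraph V, G ≤ H → H.Connected → (pathGraph k).Free H → H = G)
    (hk : k = 2 * t + 2 ∨ k = 2 * t + 3) (hn : 2 * k ≤ Fintype.card V) (S : Finset V) :
    ∑ v ∈ S, G.degree v ≤ ∑ i ∈ Finset.range S.card, wDegree (Fintype.card V) k t i := by
  rcases le_or_gt S.card t with hS | hS
  · have hT : ∑ i ∈ Finset.range S.card, wDegree (Fintype.card V) k t i =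
        S.card • (Fintype.card V - 1) := by
      rw [Finset.sum_congr rfl (g := fun _ => Fintype.card V - 1)]
      · simp
      intro i hi
      exact if_pos ((Finset.mem_range.1 hi).trans_le hS)
    rw [hT]
    exact Finset.sum_le_card_nsmul _ _ _ fun v _ => Nat.le_sub_one_of_lt (G.degree_lt_card_verts v)
  · obtain ⟨s, hs, B, hB, hdeg⟩ :=
      exists_relative_degeneracy (t := t) hG hfree hmax (by omega) (by omega)
    have h₁ := sum_card_filter_adj_le (h := k - 1 - s) (by omega) hdeg
    have h₂ := two_mul_sum_degree_le (G := G) S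
    have h₃ := sum_range_add_sum_range_le_sum_wDegree hk hn hs hS (Finset.card_le_univ S)
    have h₄ := h₁ S
    have h₅ := h₁ Finset.univ
    rw [Finset.card_univ] at h₅
    omega

end SimpleGraph

/-! ### Karamata's inequality for powers -/

/-- The tangent at `a` lies strictly below the graph elsewhere. For `a > 0` this is Bernoulli's
strict inequality at `b / a - 1`, scaled by `a ^ p`. -/
lemma Real.rpow_add_mul_sub_lt_rpow {a b p : ℝ} (ha : 0 ≤ a) (hb : 0 ≤ b) (hp : 1 < p)
    (hab : a ≠ b) : a ^ p + p * a ^ (p - 1) * (b - a) < b ^ p := by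
  rcases ha.eq_or_lt with rfl | ha'
  · rw [Real.zero_rpow (by linarith), Real.zero_rpow (by linarith)]
    have := Real.rpow_pos_of_pos (lt_of_le_of_ne hb hab) p
    linarith
  · have hs : -1 ≤ b / a - 1 := by
      have := div_nonneg hb ha
      linarith
    have hs' : b / a - 1 ≠ 0 := by
      intro h
      apply hab
      field_simp at h
      linarith
    have h := one_add_mul_self_lt_rpow_one_add hs hs' hp
    rw [add_sub_cancel, Real.div_rpow hb ha] at h
    have hpa := Real.rpow_pos_of_pos ha' p
    rw [lt_div_iff₀ hpa] at h
    have e : a ^ (p - 1) * a = a ^ p := by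
      rw [← Real.rpow_add_one ha'.ne', sub_add_cancel]
    have e' : (1 + p * (b / a - 1)) * a ^ p = a ^ p + p * a ^ (p - 1) * (b - a) := by
      rw [← e]
      field_simp
    rwa [e'] at h

lemma Real.rpow_add_mul_sub_le_rpow {a b p : ℝ} (ha : 0 ≤ a) (hb : 0 ≤ b) (hp : 1 < p) :
    a ^ p + p * a ^ (p - 1) * (b - a) ≤ b ^ p := by
  rcases eq_or_ne a b with rfl | hab
  · simp
  · exact (Real.rpow_add_mul_sub_lt_rpow ha hb hp hab).le

/-- Abel summation in inductive form: lowering the weight of a nonnegative partial sum from `c m` to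
`c (m + 1)` only decreases it. -/
lemma Antitone.sum_range_mul_nonneg {c x : ℕ → ℝ} (hc : Antitone c) (hc₀ : ∀ i, 0 ≤ c i) {n : ℕ}
    (hx : ∀ m ≤ n, 0 ≤ ∑ i ∈ Finset.range m, x i) : 0 ≤ ∑ i ∈ Finset.range n, c i * x i := by
  have key : ∀ m < n, c m * ∑ i ∈ Finset.range (m + 1), x i ≤
      ∑ i ∈ Finset.range (m + 1), c i * x i := by
    intro m
    induction m with
    | zero => simp
    | succ m ih =>
      intro hm
      have h₁ := ih (by omega)
      have h₂ := mul_le_mul_of_nonneg_right (hc (Nat.le_succ m)) (hx (m + 1) (by omega))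
      rw [Finset.sum_range_succ, Finset.sum_range_succ (fun i => c i * x i), mul_add]
      linarith
  rcases n with _ | n
  · simp
  · exact (mul_nonneg (hc₀ n) (hx _ le_rfl)).trans (key n (Nat.lt_succ_self n))

/-- A case of Karamata's inequality together with its case of equality. -/
theorem Antitone.eq_of_sum_rpow_le {d e : ℕ → ℝ} (hd : Antitone d) (hd₀ : ∀ i, 0 ≤ d i)
    (he₀ : ∀ i, 0 ≤ e i) {p : ℝ} (hp : 1 < p) {n : ℕ}
    (h : ∀ m ≤ n, ∑ i ∈ Finset.range m, d i ≤ ∑ i ∈ Finset.range m, e i)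
    (hle : ∑ i ∈ Finset.range n, e i ^ p ≤ ∑ i ∈ Finset.range n, d i ^ p) :
    ∀ i < n, d i = e i := by
  by_contra hcon
  push Not at hcon
  obtain ⟨j, hj, hne⟩ := hcon
  -- The tangent slopes at the `d i` are nonnegative and antitone, so majorization makes the total
  -- linear correction nonnegative. One index with `d i ≠ e i` then makes the power sum of `e`
  -- strictly larger.
  have h₁ : 0 ≤ ∑ i ∈ Finset.range n, (p * d i ^ (p - 1)) * (e i - d i) := by
    refine Antitone.sum_range_mul_nonneg ?_ ?_ ?_
    · intro i j hij
      exact mul_le_mul_of_nonneg_left (Real.rpow_le_rpow (hd₀ j) (hd hij) (by linarith))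
        (by linarith)
    · exact fun i => mul_nonneg (by linarith) (Real.rpow_nonneg (hd₀ i) _)
    · intro m hm
      rw [Finset.sum_sub_distrib, sub_nonneg]
      exact h m hm
  have h₂ : ∑ i ∈ Finset.range n, (d i ^ p + p * d i ^ (p - 1) * (e i - d i)) <
      ∑ i ∈ Finset.range n, e i ^ p :=
    Finset.sum_lt_sum (fun i _ => Real.rpow_add_mul_sub_le_rpow (hd₀ i) (he₀ i) hp)
      ⟨j, Finset.mem_range.2 hj, Real.rpow_add_mul_sub_lt_rpow (hd₀ j) (he₀ j) hp hne⟩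
  rw [Finset.sum_add_distrib] at h₂
  linarith

/-! ### From majorization to equal degrees -/

namespace SimpleGraph

lemma _root_.Fintype.exists_equiv_fin_antitone {V : Type*} [Fintype V] {n : ℕ}
    (hV : Fintype.card V = n) (f : V → ℕ) : ∃ φ : Fin n ≃ V, Antitone (f ∘ φ) := by
  let ψ := (Fintype.equivFinOfCardEq hV).symm
  let g : Fin n → ℕᵒᵈ := fun i => OrderDual.toDual (f (ψ i))
  refine ⟨(Tuple.sort g).trans ψ, fun i j hij => ?_⟩
  exact Tuple.monotone_sort g hij

open Classical in
/-- An edge-maximal connected graph without a path on `k` vertices whose degree power is at least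
that of `wGraph n (k - 1) t` has the same degrees. -/
theorem exists_equiv_degree_eq_wDegree {V : Type*} [Fintype V] {G : SimpleGraph V} {n k t : ℕ}
    (hV : Fintype.card V = n) (hG : G.Connected) (hfree : (pathGraph k).Free G)
    (hmax : ∀ H : SimpleGraph V, G ≤ H → H.Connected → (pathGraph k).Free H → H = G)
    (hk : k = 2 * t + 2 ∨ k = 2 * t + 3) (hn : 2 * k ≤ n) {p : ℝ} (hp : 1 < p)
    (hle : ∑ i ∈ Finset.range n, (wDegree n k t i : ℝ) ^ p ≤
      degreePower G p) :
    ∃ φ : Fin n ≃ V, ∀ i, G.degree (φ i) = wDegree n k t i := by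
  obtain ⟨φ, hφ⟩ := Fintype.exists_equiv_fin_antitone hV fun v => G.degree v
  refine ⟨φ, ?_⟩
  let d : ℕ → ℕ := fun i => if h : i < n then G.degree (φ ⟨i, h⟩) else 0
  have hd : Antitone d := by
    intro i j hij
    simp only [d]
    split_ifs with h₁ h₂
    · exact hφ (show (⟨i, h₂⟩ : Fin n) ≤ ⟨j, h₁⟩ from hij)
    · omega
    · exact Nat.zero_le _
    · exact le_rfl
  have hdφ : ∀ i : Fin n, d i = G.degree (φ i) := fun i => by simp [d]
  have hpart : ∀ m ≤ n, ∑ i ∈ Finset.range m, d i ≤ ∑ i ∈ Finset.range m, wDegree n k t i := by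
    intro m hm
    let S : Finset V := Finset.univ.map ((Fin.castLEEmb hm).trans φ.toEmbedding)
    have hS : S.card = m := by simp [S]
    have := sum_degree_le_sum_wDegree hG hfree hmax hk (hV.symm ▸ hn) S
    rw [hS, hV] at this
    refine le_trans (le_of_eq ?_) this
    rw [Finset.sum_map, Finset.sum_range]
    refine Finset.sum_congr rfl fun i _ => ?_
    exact hdφ (Fin.castLE hm i)
  have hpow : degreePower G p = ∑ i ∈ Finset.range n, (d i : ℝ) ^ p := by
    rw [degreePower, Finset.sum_range, ← Equiv.sum_comp φ]
    exact Finset.sum_congr rfl fun i _ => by rw [hdφ]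
  rw [hpow] at hle
  have := Antitone.eq_of_sum_rpow_le (d := fun i => (d i : ℝ)) (e := fun i => (wDegree n k t i : ℝ))
    (fun i j hij => Nat.cast_le.2 (hd hij)) (fun _ => Nat.cast_nonneg _) (fun _ => Nat.cast_nonneg _)
    hp (fun m hm => by exact_mod_cast hpart m hm) hle
  intro i
  rw [← hdφ]
  exact_mod_cast this i i.2

/-! ### Properties of the extremal graph -/

section WGraph

variable {n k t : ℕ}

lemma wGraph_adj {s : ℕ} {i j : Fin n} : (wGraph n k s).Adj i j ↔ i ≠ j ∧
    ((i.val < k - s ∧ j.val < k - s) ∨ (i.val < s ∧ k - s ≤ j.val) ∨ (j.val < s ∧ k - s ≤ i.val)) :=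
  Iff.rfl

open Classical in
lemma neighborFinset_wGraph_of_lt (htk : 2 * t + 2 ≤ k) {i : Fin n}
    (hi : i.val < t) : (wGraph n (k - 1) t).neighborFinset i = Finset.univ.erase i := by
  ext j
  rw [mem_neighborFinset, wGraph_adj, Finset.mem_erase, ne_comm]
  simp only [Finset.mem_univ, and_true]
  exact ⟨fun h => h.1, fun h => ⟨h, by omega⟩⟩

open Classical in
lemma neighborFinset_wGraph_of_mid {i : Fin n}
    (hi : t ≤ i.val) (hi' : i.val < k - 1 - t) :
    (wGraph n (k - 1) t).neighborFinset i =
      (Finset.univ.filter fun j : Fin n => j.val < k - 1 - t).erase i := by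
  ext j
  rw [mem_neighborFinset, wGraph_adj, Finset.mem_erase, ne_comm]
  simp only [Finset.mem_univ, true_and, Finset.mem_filter]
  refine and_congr_right fun _ => ?_
  omega

open Classical in
lemma neighborFinset_wGraph_of_le (htk : 2 * t + 2 ≤ k) {i : Fin n} (hi : k - 1 - t ≤ i.val) :
    (wGraph n (k - 1) t).neighborFinset i = Finset.univ.filter fun j : Fin n => j.val < t := by
  ext j
  rw [mem_neighborFinset, wGraph_adj]
  simp only [Finset.mem_univ, true_and, Finset.mem_filter, ne_eq, Fin.ext_iff]
  omega

lemma card_fin_filter_lt {m : ℕ} (hm : m ≤ n) :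
    (Finset.univ.filter fun j : Fin n => j.val < m).card = m := by
  rw [Fin.card_filter_val_lt, min_eq_right hm]

open Classical in
lemma degree_wGraph (htk : 2 * t + 2 ≤ k) (hn : k ≤ n) (i : Fin n) :
    (wGraph n (k - 1) t).degree i = wDegree n k t i := by
  rw [← card_neighborFinset_eq_degree, wDegree]
  split_ifs with h₁ h₂
  · rw [neighborFinset_wGraph_of_lt htk h₁, Finset.card_erase_of_mem (Finset.mem_univ _)]
    simp
  · rw [neighborFinset_wGraph_of_mid (not_lt.1 h₁) h₂, Finset.card_erase_of_mem (by simpa using h₂),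
      card_fin_filter_lt (by omega)]
    omega
  · rw [neighborFinset_wGraph_of_le htk (not_lt.1 h₂), card_fin_filter_lt (by omega)]

open Classical in
/-- The graph `wGraph n (k - 1) t` is determined by its degrees. -/
theorem eq_wGraph_of_degree (htk : 2 * t + 2 ≤ k) (hn : k ≤ n) {H : SimpleGraph (Fin n)}
    (hH : ∀ i : Fin n, H.degree i = wDegree n k t i) : H = wGraph n (k - 1) t := by
  have hcard : ∀ i, (H.neighborFinset i).card = ((wGraph n (k - 1) t).neighborFinset i).card := by
    intro i
    rw [card_neighborFinset_eq_degree, card_neighborFinset_eq_degree, hH, degree_wGraph htk hn]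
  -- Vertices of `X` have full degree. They already exhaust the degree `t` of each vertex of `Z`, so
  -- vertices of `Y` have all neighbours in `X ∪ Y` and their degree forces all of it.
  have hX : ∀ i : Fin n, i.val < t → H.neighborFinset i = (wGraph n (k - 1) t).neighborFinset i := by
    intro i hi
    refine Finset.eq_of_subset_of_card_le ?_ (hcard i).ge
    rw [neighborFinset_wGraph_of_lt htk hi]
    intro j hj
    rw [mem_neighborFinset] at hj
    exact Finset.mem_erase.2 ⟨hj.ne', Finset.mem_univ _⟩
  have hZ : ∀ i : Fin n, k - 1 - t ≤ i.val →
      H.neighborFinset i = (wGraph n (k - 1) t).neighborFinset i := by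
    intro i hi
    refine (Finset.eq_of_subset_of_card_le ?_ (hcard i).le).symm
    rw [neighborFinset_wGraph_of_le htk hi]
    intro j hj
    have hj : j.val < t := by simpa using hj
    rw [mem_neighborFinset, H.adj_comm, ← mem_neighborFinset, hX j hj,
      neighborFinset_wGraph_of_lt htk hj]
    refine Finset.mem_erase.2 ⟨?_, Finset.mem_univ _⟩
    rintro rfl
    omega
  have hY : ∀ i : Fin n, t ≤ i.val → i.val < k - 1 - t →
      H.neighborFinset i = (wGraph n (k - 1) t).neighborFinset i := by
    intro i hi hi'
    refine Finset.eq_of_subset_of_card_le ?_ (hcard i).ge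
    rw [neighborFinset_wGraph_of_mid hi hi']
    intro j hj
    rw [mem_neighborFinset] at hj
    refine Finset.mem_erase.2 ⟨hj.ne', ?_⟩
    by_contra hcon
    have hj' : k - 1 - t ≤ j.val := by simpa using hcon
    rw [H.adj_comm, ← mem_neighborFinset, hZ j hj', neighborFinset_wGraph_of_le htk hj'] at hj
    have : i.val < t := by simpa using hj
    omega
  ext i j
  rw [← mem_neighborFinset, ← mem_neighborFinset]
  rcases lt_or_ge i.val t with h | h
  · rw [hX i h]
  · rcases lt_or_ge i.val (k - 1 - t) with h' | h'
    · rw [hY i h h']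
    · rw [hZ i h']

lemma wGraph_connected (ht : 1 ≤ t) (htk : 2 * t + 2 ≤ k) (hn : k ≤ n) :
    (wGraph n (k - 1) t).Connected := by
  rw [connected_iff_exists_forall_reachable]
  refine ⟨⟨0, by omega⟩, fun j => ?_⟩
  by_cases hj : (⟨0, by omega⟩ : Fin n) = j
  · rw [hj]
  · refine Adj.reachable ⟨hj, ?_⟩
    simp only
    omega

/-- Pigeonhole: the `t + 1` disjoint pairs of consecutive positions starting at `o` cannot all meet
the `t` vertices of `X`. -/
lemma exists_not_lt_of_injOn {g : ℕ → ℕ}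
    (hinj : ∀ i < k, ∀ j < k, g i = g j → i = j) {o : ℕ} (ho : 2 * t + 1 + o < k) :
    ∃ i ≤ t, t ≤ g (2 * i + o) ∧ t ≤ g (2 * i + 1 + o) := by
  by_contra! hcon
  obtain ⟨i, hi, j, hj, hij, he⟩ := Finset.exists_ne_map_eq_of_card_lt_of_maps_to
    (s := Finset.range (t + 1)) (t := Finset.range t)
    (f := fun i => if g (2 * i + o) < t then g (2 * i + o) else g (2 * i + 1 + o))
    (by simp) (by
      intro i hi
      have hi : i ≤ t := by simpa [Nat.lt_succ_iff] using hi
      simp only [Finset.coe_range, Set.mem_Iio]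
      split_ifs with h
      · exact h
      · exact hcon i hi (not_lt.1 h))
  rw [Finset.mem_range] at hi hj
  split_ifs at he
  all_goals
    have := hinj _ (by omega) _ (by omega) he
    omega

/-- A consecutive pair avoiding `X` is an edge inside `Y`. For even `k` the set `Y` is a single
vertex. For odd `k` it has two, but the offsets `0` and `1` give two different edges of the path
inside it. -/
theorem pathGraph_free_wGraph (hk : k = 2 * t + 2 ∨ k = 2 * t + 3) :
    (pathGraph k).Free (wGraph n (k - 1) t) := by
  rintro ⟨f⟩
  let g : ℕ → ℕ := fun i => if h : i < k then (f ⟨i, h⟩).val else 0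
  have hinj : ∀ i < k, ∀ j < k, g i = g j → i = j := by
    intro i hi j hj hij
    simp only [g, dif_pos hi, dif_pos hj] at hij
    simpa using f.injective (Fin.ext hij)
  have hadj : ∀ i, i + 1 < k → t ≤ g i → t ≤ g (i + 1) →
      g i < k - 1 - t ∧ g (i + 1) < k - 1 - t ∧ g i ≠ g (i + 1) := by
    intro i hi h₁ h₂
    have hi' : i < k := by omega
    have h : (wGraph n (k - 1) t).Adj (f ⟨i, hi'⟩) (f ⟨i + 1, hi⟩) :=
      f.toHom.map_rel (by simp [pathGraph_adj])
    obtain ⟨-, h⟩ := h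
    have hne : g i ≠ g (i + 1) := fun e => by
      have := hinj _ hi' _ hi e
      omega
    simp only [g, dif_pos hi', dif_pos hi] at h₁ h₂ hne ⊢
    omega
  obtain ⟨i, hi, h₁, h₂⟩ := exists_not_lt_of_injOn (t := t) (o := 0) hinj (by omega)
  obtain ⟨a₁, a₂, a₃⟩ := hadj _ (by omega) h₁ h₂
  rcases hk with rfl | rfl
  · simp only [add_zero] at *
    omega
  · obtain ⟨j, hj, h₃, h₄⟩ := exists_not_lt_of_injOn (t := t) (o := 1) hinj (by omega)
    obtain ⟨b₁, b₂, b₃⟩ := hadj _ (by omega) h₃ h₄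
    simp only [add_zero] at *
    have : g (2 * i) = g (2 * j + 1) ∨ g (2 * i) = g (2 * j + 1 + 1) := by omega
    rcases this with h | h
    · have := hinj _ (by omega) _ (by omega) h
      omega
    · have e := hinj _ (by omega) _ (by omega) h
      have : g (2 * i + 1) = g (2 * j + 1) := by omega
      have := hinj _ (by omega) _ (by omega) this
      omega

end WGraph

/-! ### Invariance and monotonicity of the degree power -/

section DegreePower

lemma degreePower_congr {V W : Type*} [Fintype V] [Fintype W] {G : SimpleGraph V}
    {H : SimpleGraph W} (e : G ≃g H) (p : ℝ) : degreePower G p = degreePower H p := by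
  classical
  rw [degreePower, degreePower, ← Equiv.sum_comp e.toEquiv]
  refine Finset.sum_congr rfl fun v _ => ?_
  congr 2
  exact (e.degree_eq v).symm

lemma degreePower_wGraph {n k t : ℕ} (htk : 2 * t + 2 ≤ k) (hn : k ≤ n) (p : ℝ) :
    degreePower (wGraph n (k - 1) t) p = ∑ i ∈ Finset.range n, (wDegree n k t i : ℝ) ^ p := by
  rw [degreePower, Finset.sum_range]
  refine Finset.sum_congr rfl fun i _ => ?_
  rw [← degree_wGraph htk hn]

lemma degreePower_lt_of_lt {V : Type*} [Fintype V] {G H : SimpleGraph V} (h : G < H) {p : ℝ}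
    (hp : 0 < p) : degreePower G p < degreePower H p := by
  classical
  have hle := h.le
  obtain ⟨v, w, hvw, hn⟩ : ∃ v w, H.Adj v w ∧ ¬ G.Adj v w := by
    by_contra! hcon
    exact h.not_ge fun v w => hcon v w
  refine Finset.sum_lt_sum (fun u _ => ?_) ⟨v, Finset.mem_univ _, ?_⟩
  · refine Real.rpow_le_rpow (Nat.cast_nonneg _) (Nat.cast_le.2 ?_) hp.le
    convert degree_le_of_le hle
  · refine Real.rpow_lt_rpow (Nat.cast_nonneg _) (Nat.cast_lt.2 ?_) hp
    rw [← card_neighborFinset_eq_degree, ← card_neighborFinset_eq_degree]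
    refine Finset.card_lt_card (Finset.ssubset_iff_subset_ne.2 ⟨?_, ?_⟩)
    · intro u hu
      rw [mem_neighborFinset] at hu ⊢
      exact hle hu
    · intro he
      have : w ∈ G.neighborFinset v := by rw [he]; simpa using hvw
      exact hn (by simpa using this)

end DegreePower

end SimpleGraph

/-! ### The characterization of maximizers -/

open SimpleGraph in
/-- A maximizer of the degree power is isomorphic to `wGraph n (k - 1) t`. -/
theorem IsMaxDegreePowerConnectedPathFree.nonempty_iso {V : Type*} [Fintype V]
    {G : SimpleGraph V} {k t : ℕ} {p : ℝ} (ht : 1 ≤ t) (hk : k = 2 * t + 2 ∨ k = 2 * t + 3)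
    (hn : 2 * k ≤ Fintype.card V) (hp : 1 < p) (h : IsMaxDegreePowerConnectedPathFree G k p) :
    Nonempty (G ≃g wGraph (Fintype.card V) (k - 1) t) := by
  classical
  obtain ⟨hG, hfree, hmax⟩ := h
  have hmax' : ∀ H : SimpleGraph V, G ≤ H → H.Connected → (pathGraph k).Free H → H = G := by
    intro H hGH hH hHf
    by_contra hne
    have := degreePower_lt_of_lt (lt_of_le_of_ne hGH (Ne.symm hne)) (show 0 < p by linarith)
    exact (hmax H hH hHf).not_gt this
  -- A copy of `W` on the vertex set `V` is a competitor of `G`.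
  have hle : ∑ i ∈ Finset.range (Fintype.card V), (wDegree (Fintype.card V) k t i : ℝ) ^ p ≤
      degreePower G p := by
    rw [← degreePower_wGraph (by omega) (by omega)]
    let e := Iso.map (Fintype.equivFin V).symm (wGraph (Fintype.card V) (k - 1) t)
    rw [degreePower_congr e]
    refine hmax _ ?_ ?_
    · exact e.connected_iff.1 (wGraph_connected ht (by omega) (by omega))
    · exact (free_congr_right e).1 (pathGraph_free_wGraph hk)
  obtain ⟨φ, hφ⟩ := exists_equiv_degree_eq_wDegree rfl hG hfree hmax' hk hn hp hle
  have := eq_wGraph_of_degree (n := Fintype.card V) (k := k) (t := t) (H := G.comap φ)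
      (by omega) (by omega) fun i => by
    rw [← hφ i]
    exact ((Iso.comap φ G).degree_eq i).symm
  rw [← this]
  exact ⟨(Iso.comap φ G).symm⟩

theorem theorem4p6 {V : Type*} [Fintype V] (G : SimpleGraph V) (n k : ℕ) (p : ℝ)
    (hk : 4 ≤ k) (hn : 2 * k ≤ n) (hp : 2 ≤ p) (hV : Fintype.card V = n) :
    IsMaxDegreePowerConnectedPathFree G k p ↔ Nonempty (G ≃g wGraph n (k - 1) (k / 2 - 1)) := by
  subst hV
  have ht : 1 ≤ k / 2 - 1 := by omega
  have hk' : k = 2 * (k / 2 - 1) + 2 ∨ k = 2 * (k / 2 - 1) + 3 := by omega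
  have hp' : 1 < p := by linarith
  refine ⟨fun h => h.nonempty_iso ht hk' hn hp', ?_⟩
  rintro ⟨e⟩
  have hGc : G.Connected := e.connected_iff.2 (SimpleGraph.wGraph_connected ht (by omega) (by omega))
  have hGf : (SimpleGraph.pathGraph k).Free G :=
    (SimpleGraph.free_congr_right e).2 (SimpleGraph.pathGraph_free_wGraph hk')
  classical
  -- Some maximizer `H` exists by finiteness. It is isomorphic to `W`, hence to `G`, so `G` has the
  -- same degree power.
  obtain ⟨H, hH, hHmax⟩ := Finset.exists_max_image
    (Finset.univ.filter fun H : SimpleGraph V => H.Connected ∧ (SimpleGraph.pathGraph k).Free H)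
    (fun H => degreePower H p) ⟨G, Finset.mem_filter.2 ⟨Finset.mem_univ _, hGc, hGf⟩⟩
  obtain ⟨-, hHc, hHf⟩ := Finset.mem_filter.1 hH
  have hHM : IsMaxDegreePowerConnectedPathFree H k p :=
    ⟨hHc, hHf, fun H' h₁ h₂ => hHmax H' (Finset.mem_filter.2 ⟨Finset.mem_univ _, h₁, h₂⟩)⟩
  obtain ⟨e'⟩ := hHM.nonempty_iso ht hk' hn hp'
  refine ⟨hGc, hGf, fun H' h₁ h₂ => ?_⟩
  rw [SimpleGraph.degreePower_congr (e.trans e'.symm)]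
  exact hHM.2.2 H' h₁ h₂
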